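/- For a finite group $G$, a maximal cyclic subgroup of $G$ is a cyclic subgroup of $G$ that is not properly contained in any cyclic subgroup of $G$. A family of finite groups is called MCB (maximal cyclic bounded) if, for every natural number $n$, there are, up to isomorphism, only finitely many groups in the family with at most $n$ maximal cyclic subgroups. Theorem 1.3. The family of finite groups $G$ such that every nontrivial Sylow subgroup of the center $Z(G)$ is noncyclic is MCB. In particular, the family of finite groups with trivial center is MCB. -/

import Mathlib

universe u

/-- `H` is a maximal cyclic subgroup of `G`: it is cyclic and it is not properly contained in any
cyclic subgroup of `G`. -/
def IsMaximalCyclic {G : Type u} [Group G] (H : Subgroup G) : Prop :=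
  Maximal (fun K : Subgroup G => IsCyclic K) H

/-- The number `λ(G)` of maximal cyclic subgroups of `G` (used for finite `G` only, where the set of
subgroups is finite). -/
noncomputable def numMaximalCyclic (G : Type u) [Group G] : ℕ :=
  {H : Subgroup G | IsMaximalCyclic H}.ncard

/-- A family `F` of finite groups is maximal cyclic bounded (MCB) if, for every natural number `n`,
there are, up to isomorphism, only finitely many groups in `F` with at most `n` maximal cyclic
subgroups. -/
def IsMCB (F : Set FiniteGrp.{u}) : Prop :=
  ∀ n : ℕ, ∃ S : Set FiniteGrp.{u}, S.Finite ∧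
    ∀ G ∈ F, numMaximalCyclic G ≤ n → ∃ H ∈ S, Nonempty (G ≃* H)

/-! Let D be the intersection of the n maximal cyclic subgroups. They cover G irredundantly, since a
generator of one lies in no other, so B. H. Neumann's coset covering lemma gives |G : D| ≤ n ^ n. D
is central, since each g lies in a cyclic subgroup containing D. If D had an element d of prime
order p, every element of order p would share a cyclic subgroup with d, so ⟨d⟩ would be the only
subgroup of order p and the nontrivial Sylow p-subgroup of the center would be cyclic. So D = 1 and
|G| ≤ n ^ n. -/

open scoped Pointwise in
/-- If a left coset of a subgroup `I` is covered by finitely many subgroups, one of them meets `I`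
in a subgroup of relative index at most the number of subgroups. -/
theorem Subgroup.exists_relIndex_le_card_of_coset_cover {G : Type*} [Group G] (I : Subgroup G)
    (T : Finset (Subgroup G)) (x : G) (h : ∀ i ∈ I, ∃ H ∈ T, x * i ∈ H) :
    ∃ H ∈ T, H.relIndex I ≤ T.card := by
  classical
  let T' := T.filter fun H => ∃ i : I, x * i ∈ H
  -- The `i : I` with `x * i ∈ H` form a left coset of `H ⊓ I` in `I`, or none exist; the default 1
  -- is never used on `T'`.
  let g : Subgroup G → I := fun H => if hH : ∃ i : I, x * i ∈ H then hH.choose else 1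
  have hg : ∀ H ∈ T', x * g H ∈ H := by
    intro H hH
    have hH' := (Finset.mem_filter.1 hH).2
    simp only [g, dif_pos hH']
    exact hH'.choose_spec
  have hcov : ⋃ H ∈ T', g H • ((H.subgroupOf I : Subgroup I) : Set I) = Set.univ := by
    refine Set.eq_univ_of_forall fun i => ?_
    obtain ⟨H, hHT, hH⟩ := h i i.2
    have hT' : H ∈ T' := Finset.mem_filter.2 ⟨hHT, i, hH⟩
    simp only [Set.mem_iUnion]
    refine ⟨H, hT', Set.mem_smul_set_iff_inv_smul_mem.2 ?_⟩
    have := H.mul_mem (H.inv_mem (hg H hT')) hH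
    simpa [Subgroup.mem_subgroupOf, mul_assoc] using this
  obtain ⟨H, hH, -, hle⟩ := Subgroup.exists_index_le_card_of_leftCoset_cover hcov
  exact ⟨H, (Finset.mem_filter.1 hH).1, hle.trans (Finset.card_filter_le _ _)⟩

/-- The intersection of an irredundant cover of a group by `n` subgroups has index at most `n ^ n`,
in a form relative to the intersection of a subfamily. -/
theorem Subgroup.index_inf_le_of_irredundant_cover {G : Type*} [Group G] [DecidableEq (Subgroup G)]
    (T : Finset (Subgroup G)) (hcov : ∀ g : G, ∃ H ∈ T, g ∈ H)
    (hirr : ∀ H ∈ T, ∃ g, ∀ K ∈ T, g ∈ K → K = H) (S : Finset (Subgroup G)) (hS : S ⊆ T) :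
    (T.inf id).index ≤ T.card ^ (T \ S).card * (S.inf id).index := by
  induction hm : (T \ S).card generalizing S with
  | zero =>
    rw [Finset.card_eq_zero, Finset.sdiff_eq_empty_iff_subset] at hm
    rw [hS.antisymm hm]
    simp
  | succ m ih =>
    obtain ⟨H, hH⟩ := Finset.card_pos.1 (by omega : 0 < (T \ S).card)
    rw [Finset.mem_sdiff] at hH
    obtain ⟨x, hx⟩ := hirr H hH.1
    -- Since `x` lies in no member of `T` but `H ∉ S`, its coset of `S.inf id` misses every member
    -- of `S`, so `T \ S` covers it.
    obtain ⟨K, hK, hle⟩ := (S.inf id).exists_relIndex_le_card_of_coset_cover (T \ S) x (by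
      intro i hi
      obtain ⟨K, hKT, hxi⟩ := hcov (x * i)
      refine ⟨K, Finset.mem_sdiff.2 ⟨hKT, fun hKS => hH.2 ?_⟩, hxi⟩
      have hiK : i ∈ K := (Finset.inf_le hKS : S.inf id ≤ id K) hi
      exact hx K hKT ((K.mul_mem_cancel_right hiK).1 hxi) ▸ hKS)
    rw [Finset.mem_sdiff] at hK
    have hcard : (T \ insert K S).card = m := by
      rw [Finset.sdiff_insert, Finset.card_erase_of_mem (Finset.mem_sdiff.2 hK), hm,
        Nat.add_sub_cancel]
    have hidx : ((insert K S).inf id).index = K.relIndex (S.inf id) * (S.inf id).index := by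
      rw [Finset.inf_insert, id, ← Subgroup.relIndex_mul_index inf_le_right,
        Subgroup.inf_relIndex_right]
    refine (ih (insert K S) (Finset.insert_subset hK.1 hS) hcard).trans ?_
    rw [hidx, ← mul_assoc, pow_succ]
    exact Nat.mul_le_mul_right _ (Nat.mul_le_mul_left _
      (hle.trans (Finset.card_le_card Finset.sdiff_subset)))

/-- A cyclic group has at most one subgroup of order `p`. -/
theorem IsCyclic.mem_zpowers_of_pow_prime_eq_one {G : Type*} [Group G] [Finite G] [IsCyclic G]
    {p : ℕ} (hp : p.Prime) {a b : G} (ha : orderOf a = p) (hb : b ^ p = 1) :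
    b ∈ Subgroup.zpowers a := by
  classical
  have := Fintype.ofFinite G
  have hsub : (Subgroup.zpowers a : Set G).toFinset ⊆ Finset.univ.filter fun x : G => x ^ p = 1 := by
    intro x hx
    obtain ⟨k, rfl⟩ := Subgroup.mem_zpowers_iff.1 (by simpa using hx)
    rw [Finset.mem_filter]
    refine ⟨Finset.mem_univ _, ?_⟩
    rw [← zpow_natCast, zpow_comm, zpow_natCast, ← ha, pow_orderOf_eq_one, one_zpow]
  -- At most p solutions of `x ^ p = 1` exist, and the powers of `a` already supply p.
  have heq := Finset.eq_of_subset_of_card_le hsub (by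
    refine (IsCyclic.card_pow_eq_one_le hp.pos).trans_eq ?_
    rw [Set.toFinset_card, ← Nat.card_eq_fintype_card]
    exact (ha.symm.trans (Nat.card_zpowers a).symm))
  have hbm : b ∈ Finset.univ.filter fun x : G => x ^ p = 1 := by simpa using hb
  rw [← heq] at hbm
  simpa using hbm

theorem Subgroup.mem_zpowers_of_isCyclic {G : Type*} [Group G] [Finite G] {C : Subgroup G}
    (hC : IsCyclic C) {p : ℕ} (hp : p.Prime) {a b : G} (haC : a ∈ C) (hbC : b ∈ C)
    (ha : orderOf a = p) (hb : b ^ p = 1) : b ∈ Subgroup.zpowers a := by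
  have := IsCyclic.mem_zpowers_of_pow_prime_eq_one (G := C) hp (a := ⟨a, haC⟩) (b := ⟨b, hbC⟩)
    (by rwa [Subgroup.orderOf_mk]) (by ext; simpa using hb)
  obtain ⟨k, hk⟩ := Subgroup.mem_zpowers_iff.1 this
  exact Subgroup.mem_zpowers_iff.2 ⟨k, by simpa using congrArg Subtype.val hk⟩

theorem exists_isMaximalCyclic_ge {G : Type u} [Group G] [Finite G] (K : Subgroup G)
    (hK : IsCyclic K) : ∃ H : Subgroup G, K ≤ H ∧ IsMaximalCyclic H :=
  Finite.exists_le_maximal (p := fun K : Subgroup G => IsCyclic K) hK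

theorem exists_isMaximalCyclic_mem {G : Type u} [Group G] [Finite G] (g : G) :
    ∃ H : Subgroup G, g ∈ H ∧ IsMaximalCyclic H := by
  obtain ⟨H, hle, hH⟩ := exists_isMaximalCyclic_ge (Subgroup.zpowers g) inferInstance
  exact ⟨H, hle (Subgroup.mem_zpowers g), hH⟩

theorem IsMaximalCyclic.exists_zpowers_eq {G : Type u} [Group G] {H : Subgroup G}
    (hH : IsMaximalCyclic H) : ∃ g : G, Subgroup.zpowers g = H :=
  H.isCyclic_iff_exists_zpowers_eq_top.1 hH.1

/-- A finite abelian `p`-group with at most one subgroup of order `p` is cyclic. -/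
theorem IsPGroup.isCyclic_of_unique_subgroup_of_prime_order {P : Type u} [CommGroup P] [Finite P]
    {p : ℕ} (hp : p.Prime) (hP : IsPGroup p P)
    (h : ∀ a b : P, orderOf a = p → b ^ p = 1 → b ∈ Subgroup.zpowers a) : IsCyclic P := by
  have : Fact p.Prime := ⟨hp⟩
  rcases subsingleton_or_nontrivial P with _ | _
  · infer_instance
  obtain ⟨g, hg⟩ := exists_ne (1 : P)
  obtain ⟨H, hgH, hH⟩ := exists_isMaximalCyclic_mem g
  obtain ⟨c, rfl⟩ := hH.exists_zpowers_eq
  obtain ⟨r, hr⟩ := (IsPGroup.iff_orderOf.1 hP) c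
  have hc : c ≠ 1 := by
    rintro rfl
    exact hg (by simpa using hgH)
  have hpc : p ∣ orderOf c := by
    rw [hr]
    refine dvd_pow_self p fun hr0 => hc ?_
    simpa [hr0] using hr
  have htors : ∀ b : P, b ^ p = 1 → b ∈ Subgroup.zpowers c := by
    intro b hb
    have := h (c ^ (orderOf c / p)) b (orderOf_pow_orderOf_div (orderOf_pos c).ne' hpc) hb
    exact (Subgroup.zpowers_le.2 (Subgroup.npow_mem_zpowers c _)) this
  -- Write `y ^ p = c ^ j`. If p ∣ j, dividing `y` by a power of `c` leaves p-torsion; otherwise `c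
  -- ^ j` generates ⟨c⟩, so ⟨c⟩ ≤ ⟨y⟩ and maximality applies.
  have hroot : ∀ y : P, y ^ p ∈ Subgroup.zpowers c → y ∈ Subgroup.zpowers c := by
    intro y hy
    obtain ⟨j, hj⟩ := mem_powers_iff_mem_zpowers.2 hy
    replace hj : c ^ j = y ^ p := hj
    by_cases hpj : p ∣ j
    · obtain ⟨i, rfl⟩ := hpj
      have hb := htors (y * (c ^ i)⁻¹) (by
        rw [mul_pow, inv_pow, ← pow_mul, mul_comm i p, hj, mul_inv_cancel])
      exact (Subgroup.mul_mem_cancel_right _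
        (inv_mem (Subgroup.npow_mem_zpowers c i))).1 hb
    · have hcop : c ∈ Subgroup.zpowers (c ^ j) := by
        rw [mem_zpowers_pow_iff, hr]
        exact Nat.Coprime.pow_right _ ((Nat.Prime.coprime_iff_not_dvd hp).2 hpj).symm
      have hle : Subgroup.zpowers c ≤ Subgroup.zpowers y := by
        rw [Subgroup.zpowers_le]
        rw [hj] at hcop
        exact (Subgroup.zpowers_le.2 (Subgroup.npow_mem_zpowers y p)) hcop
      exact hH.2 (inferInstanceAs (IsCyclic (Subgroup.zpowers y))) hle (Subgroup.mem_zpowers y)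
  refine ⟨c, fun y => ?_⟩
  obtain ⟨k, hk⟩ := hP y
  induction k generalizing y with
  | zero =>
    rw [pow_zero, pow_one] at hk
    exact hk ▸ one_mem (Subgroup.zpowers c)
  | succ k ih => exact hroot y (ih (y ^ p) (by rw [← pow_mul, ← pow_succ', hk]))

/-- The intersection of all maximal cyclic subgroups has index at most `n ^ n`, where `n` is the
number of maximal cyclic subgroups. -/
theorem index_sInf_isMaximalCyclic_le (G : Type u) [Group G] [Finite G] :
    (sInf {H : Subgroup G | IsMaximalCyclic H}).index ≤
      numMaximalCyclic G ^ numMaximalCyclic G := by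
  classical
  have hfin : {H : Subgroup G | IsMaximalCyclic H}.Finite := Set.toFinite _
  have hT : ∀ H, H ∈ hfin.toFinset ↔ IsMaximalCyclic H := fun H => by simp
  have key := Subgroup.index_inf_le_of_irredundant_cover hfin.toFinset
    (fun g => (exists_isMaximalCyclic_mem g).imp fun H hH => ⟨(hT H).2 hH.2, hH.1⟩)
    (fun H hH => by
      obtain ⟨g, rfl⟩ := ((hT H).1 hH).exists_zpowers_eq
      refine ⟨g, fun K hK hg => ?_⟩
      have hK' := (hT K).1 hK
      exact (((hT _).1 hH).eq_of_le hK'.1 (Subgroup.zpowers_le.2 hg)).symm)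
    ∅ (Finset.empty_subset _)
  rw [Finset.inf_id_eq_sInf, hfin.coe_toFinset] at key
  simpa [numMaximalCyclic, Set.ncard_eq_toFinset_card _ hfin] using key

theorem sInf_isMaximalCyclic_le_center (G : Type u) [Group G] [Finite G] :
    sInf {H : Subgroup G | IsMaximalCyclic H} ≤ Subgroup.center G := by
  intro d hd
  rw [Subgroup.mem_center_iff]
  intro g
  obtain ⟨H, hgH, hH⟩ := exists_isMaximalCyclic_mem g
  have hdH : d ∈ H := Subgroup.mem_sInf.1 hd H hH
  obtain ⟨c, rfl⟩ := hH.exists_zpowers_eq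
  obtain ⟨i, rfl⟩ := Subgroup.mem_zpowers_iff.1 hgH
  obtain ⟨j, rfl⟩ := Subgroup.mem_zpowers_iff.1 hdH
  exact (Commute.refl c).zpow_zpow i j

/-- If every nontrivial Sylow subgroup of the center is noncyclic, then the maximal cyclic
subgroups intersect trivially. -/
theorem sInf_isMaximalCyclic_eq_bot (G : Type u) [Group G] [Finite G]
    (h : ∀ (p : ℕ) [Fact p.Prime] (P : Sylow p (Subgroup.center G)),
      Nontrivial P → ¬ IsCyclic P) :
    sInf {H : Subgroup G | IsMaximalCyclic H} = ⊥ := by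
  set D := sInf {H : Subgroup G | IsMaximalCyclic H}
  by_contra hne
  obtain ⟨p, hp, hpD⟩ := Nat.exists_prime_and_dvd (mt Subgroup.card_eq_one.1 hne)
  have : Fact p.Prime := ⟨hp⟩
  obtain ⟨⟨d, hdD⟩, hd⟩ := exists_prime_orderOf_dvd_card' p hpD
  rw [Subgroup.orderOf_mk] at hd
  have hdZ := sInf_isMaximalCyclic_le_center G hdD
  let P : Sylow p (Subgroup.center G) := default
  have hdvd : p ∣ Nat.card P := by
    refine P.dvd_card_of_dvd_card (hd ▸ ?_)
    rw [← Subgroup.orderOf_mk _ hdZ]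
    exact orderOf_dvd_natCard _
  have hnt : Nontrivial P := by
    rw [← Finite.one_lt_card_iff_nontrivial]
    exact hp.one_lt.trans_le (Nat.le_of_dvd Nat.card_pos hdvd)
  have hzd : ∀ a b : G, orderOf a = p → b ^ p = 1 → b ∈ Subgroup.zpowers a := by
    intro a b ha hb
    obtain ⟨A, haA, hA⟩ := exists_isMaximalCyclic_mem a
    obtain ⟨B, hbB, hB⟩ := exists_isMaximalCyclic_mem b
    have hda := Subgroup.mem_zpowers_of_isCyclic hA.1 hp haA (Subgroup.mem_sInf.1 hdD A hA) ha
      (hd ▸ pow_orderOf_eq_one d)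
    have hbd := Subgroup.mem_zpowers_of_isCyclic hB.1 hp (Subgroup.mem_sInf.1 hdD B hB) hbB hd hb
    exact Subgroup.zpowers_le.2 hda hbd
  let : CommGroup P :=
    { (inferInstance : Group P) with mul_comm := fun a b => by ext; exact (b.1.2.comm a).symm }
  refine h p P hnt (IsPGroup.isCyclic_of_unique_subgroup_of_prime_order (P := P) hp P.isPGroup' fun a b ha hb => ?_)
  have hab := hzd a b (by rw [Subgroup.orderOf_coe, Subgroup.orderOf_coe, ha])
    (by exact_mod_cast congrArg (fun x : P => (x : G)) hb)
  obtain ⟨k, hk⟩ := Subgroup.mem_zpowers_iff.1 hab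
  exact Subgroup.mem_zpowers_iff.2 ⟨k, by ext; simpa using hk⟩

/-- The multiplication determines the group structure. -/
instance Group.finite_of_finite (α : Type*) [Finite α] : Finite (Group α) :=
  Finite.of_injective (fun s : Group α => s.mul) fun s t hst => Group.ext (by
    ext x y
    exact congrFun (congrFun hst x) y)

theorem FiniteGrp.exists_group_mulEquiv_of_equiv (G : FiniteGrp.{u}) {α : Type u} [Finite α]
    (e : G ≃ α) : ∃ s : Group α, Nonempty (G ≃* @FiniteGrp.of α s _) := by
  let s : Group α := e.symm.group
  exact ⟨s, ⟨e.symm.mulEquiv.symm⟩⟩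

/-- Up to isomorphism, there are only finitely many groups of order at most `N`. -/
theorem FiniteGrp.exists_finite_of_card_le (N : ℕ) :
    ∃ S : Set FiniteGrp.{u}, S.Finite ∧
      ∀ G : FiniteGrp.{u}, Nat.card G ≤ N → ∃ H ∈ S, Nonempty (G ≃* H) := by
  refine ⟨⋃ m ∈ Set.Iic N, Set.range fun s : Group (ULift.{u} (Fin m)) =>
    @FiniteGrp.of (ULift.{u} (Fin m)) s _, ?_, fun G hG => ?_⟩
  · exact (Set.finite_Iic N).biUnion fun m _ => Set.finite_range _
  · let e : G ≃ ULift.{u} (Fin (Nat.card G)) := (Finite.equivFin G).trans Equiv.ulift.symm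
    obtain ⟨s, hs⟩ := G.exists_group_mulEquiv_of_equiv e
    refine ⟨@FiniteGrp.of _ s _, ?_, hs⟩
    simp only [Set.mem_iUnion]
    exact ⟨_, hG, s, rfl⟩

theorem theorem1p3 :
    IsMCB {G : FiniteGrp.{u} | ∀ (p : ℕ) [Fact p.Prime] (P : Sylow p (Subgroup.center G)),
      Nontrivial P → ¬ IsCyclic P} ∧
    IsMCB {G : FiniteGrp.{u} | Subgroup.center G = ⊥} := by
  have main : IsMCB {G : FiniteGrp.{u} | ∀ (p : ℕ) [Fact p.Prime]
      (P : Sylow p (Subgroup.center G)), Nontrivial P → ¬ IsCyclic P} := by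
    intro n
    obtain ⟨S, hS, hcard⟩ := FiniteGrp.exists_finite_of_card_le.{u} (n ^ n)
    refine ⟨S, hS, fun G hG hn => hcard G ?_⟩
    have hle := index_sInf_isMaximalCyclic_le G
    rw [sInf_isMaximalCyclic_eq_bot G hG, Subgroup.index_bot] at hle
    exact hle.trans (Nat.pow_self_mono hn)
  refine ⟨main, fun n => ?_⟩
  obtain ⟨S, hS, h⟩ := main n
  refine ⟨S, hS, fun G hG => h G fun p _ P hP => ?_⟩
  have hsub : Subsingleton (Subgroup.center G) := by
    rw [show Subgroup.center G = ⊥ from hG]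
    infer_instance
  exact absurd hP (not_nontrivial_iff_subsingleton.2 inferInstance)
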